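/- Let $K$ be the field of rational functions in $x_1,\dots,x_n,q,t$ with real coefficients. Let $\mathrm{Sym}$ be the formal ring of symmetric functions, i.e. the polynomial ring over $\mathbb R$ in the power sums $\Psi_1,\Psi_2,\dots$. It acts on $K$ by letting $\Psi_i$ ($i\ge 1$) raise every monomial in $x_1,\dots,x_n,q,t$, in numerator and denominator, to the power $i$, real coefficients being fixed; for $E\in K$, $f\mapsto f[E]$ is the $\mathbb R$-algebra homomorphism $\mathrm{Sym}\to K$ sending $\Psi_i$ to $\Psi_i[E]$. Let $S_m\in\mathrm{Sym}$ be the complete symmetric functions, given by $S_0=1$, $mS_m=\sum_{i=1}^m\Psi_iS_{m-i}$ for $m\ge 1$, and $S_m=0$ for $m<0$. For a partition $\lambda=(\lambda_1\ge\cdots\ge\lambda_n\ge 0)$ with $\ell(\lambda)\le n$ put $S_\lambda=\det\left(S_{\lambda_i-i+j}\right)_{1\le i,j\le n}$. Write $X=x_1+\cdots+x_n$, $X^t=X(t-1)$ and $X^{tq}=X(t-1)/(q-1)$. The Macdonald operator $M_k$ is $$M_k=t^{\binom k2}\sum_{I\subseteq\{1,\dots,n\},\ |I|=k}\ \prod_{i\in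 I,\ j\notin I}\frac{t x_i-x_j}{x_i-x_j}\ \Theta_{i_k}\cdots\Theta_{i_1},\qquad I=\{i_1<\cdots<i_k\},$$ where $\Theta_l:f[X]\mapsto f[X+(q-1)x_l]$ is the substitution $x_l\mapsto q\,x_l$. **Theorem 2.1.** For every $k$ and every partition $\lambda$ with $\ell(\lambda)\le n$, $$M_k\,S_\lambda[X^{tq}]=\sum_{1\le i_1<\cdots<i_k\le n}t^{(n-i_1)+\cdots+(n-i_k)}\ \det\Big(S_{\lambda_i-i+j}\big[X^{tq}+\varepsilon_jX^t\big]\Big)_{1\le i,j\le n},$$ where $\varepsilon_j=1$ if $j\in\{i_1,\dots,i_k\}$ and $\varepsilon_j=0$ otherwise; that is, each term is the Jacobi–Trudi determinant of $S_\lambda[X^{tq}]$ in which $X^t$ has been added to the alphabet in the columns $i_1,\dots,i_k$. Moreover, for every integer $m$, $S_m[X^{tq}+X^t]=q^mS_m[X^{tq}]$, and hence $$M_k\,S_\lambda[X^{tq}]=\sum_{1\le i_1<\cdots<i_k\le n}t^{(n-i_1)+\cdots+(n-i_k)}\ \det\Big(q^{\varepsilon_j(\lambda_i-i+j)}S_{\lambda_i-i+j}[X^{tq}]\Big)_{1\le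 i,j\le n}.$$ -/

import Mathlib

namespace MacdonaldSchur

/-- The indeterminates `x₁, …, xₙ, q, t` (with `x` indexed from `0`). -/
inductive Var (n : ℕ) : Type
  | x : Fin n → Var n
  | q : Var n
  | t : Var n

/-- The field of rational functions in `x₁, …, xₙ, q, t` with real coefficients. -/
abbrev RatFn (n : ℕ) : Type := FractionRing (MvPolynomial (Var n) ℝ)

/-- An indeterminate, viewed as a rational function. -/
noncomputable def var {n : ℕ} (v : Var n) : RatFn n :=
  algebraMap (MvPolynomial (Var n) ℝ) (RatFn n) (MvPolynomial.X v)

/-- The indeterminate `x_i`. -/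
noncomputable def x {n : ℕ} (i : Fin n) : RatFn n := var (Var.x i)

/-- The indeterminate `q`. -/
noncomputable def q (n : ℕ) : RatFn n := var Var.q

/-- The indeterminate `t`. -/
noncomputable def t (n : ℕ) : RatFn n := var Var.t

/-! ### The formal ring of symmetric functions and its action on rational functions -/

/-- The formal ring of symmetric functions: the polynomial ring over `ℝ` in the power sums
`Ψ₁, Ψ₂, Ψ₃, …`. -/
abbrev Sym : Type := MvPolynomial ℕ+ ℝ

/-- The power sum `Ψ_i` as an element of the ring of symmetric functions. -/
noncomputable def powerSum (i : ℕ+) : Sym := MvPolynomial.X i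

/-- The action `E ↦ Ψ_i[E]` on rational functions: every monomial in `x₁, …, xₙ, q, t`, in the
numerator and in the denominator, is raised to the power `i`; real coefficients are fixed. -/
noncomputable def psi {n : ℕ} (i : ℕ+) : RatFn n →+* RatFn n :=
  IsFractionRing.map (A := MvPolynomial (Var n) ℝ) (B := MvPolynomial (Var n) ℝ)
    (j := (MvPolynomial.expand (i : ℕ) : MvPolynomial (Var n) ℝ →ₐ[ℝ] _).toRingHom)
    (MvPolynomial.expand_injective i.pos)

/-- The action `f[E]` of a symmetric function `f` on a rational function `E`: the value at `f` of
the algebra homomorphism that sends the power sum `Ψ_i` to `Ψ_i[E]`. -/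
noncomputable def pleth {n : ℕ} (f : Sym) (E : RatFn n) : RatFn n :=
  MvPolynomial.aeval (fun i : ℕ+ => psi i E) f

/-- The complete symmetric functions `S_m`, `m ≥ 0`, in terms of power sums, by Newton's
identities `S₀ = 1`, `m S_m = Ψ₁ S_{m-1} + Ψ₂ S_{m-2} + ⋯ + Ψ_m S₀`. -/
noncomputable def completeNat : ℕ → Sym
  | 0 => 1
  | m + 1 => MvPolynomial.C ((m + 1 : ℝ)⁻¹) *
      ∑ i : Fin (m + 1), powerSum i.val.succPNat * completeNat (m - i.val)

/-- The complete symmetric functions `S_m`, with `S_m = 0` for `m < 0`. -/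
noncomputable def complete (m : ℤ) : Sym :=
  if m < 0 then 0 else completeNat m.toNat

/-- The Schur function `S_λ`, `λ = (λ₁, …, λₙ)`, as the determinant of the complete functions
`S_{λ_i - i + j}`. -/
noncomputable def schur {n : ℕ} (lam : Fin n → ℕ) : Sym :=
  (Matrix.of fun i j : Fin n => complete ((lam i : ℤ) - (i.val : ℤ) + (j.val : ℤ))).det

/-! ### The alphabets `X`, `X^t = X(t-1)` and `X^{tq} = X(t-1)/(q-1)` -/

/-- `X = x₁ + ⋯ + xₙ`. -/
noncomputable def X (n : ℕ) : RatFn n := ∑ i : Fin n, x i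

/-- `X^t = X(t-1)`. -/
noncomputable def Xt (n : ℕ) : RatFn n := X n * (t n - 1)

/-- `X^{tq} = X(t-1)/(q-1)`. -/
noncomputable def Xtq (n : ℕ) : RatFn n := X n * (t n - 1) / (q n - 1)

/-! ### The Macdonald operators -/

/-- The polynomial substitution `x_l ↦ q x_l`, fixing all other indeterminates. -/
noncomputable def thetaPoly {n : ℕ} (l : Fin n) :
    MvPolynomial (Var n) ℝ →ₐ[ℝ] MvPolynomial (Var n) ℝ :=
  MvPolynomial.aeval fun v => match v with
    | Var.x i =>
        if i = l then MvPolynomial.X Var.q * MvPolynomial.X (Var.x i)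
        else MvPolynomial.X (Var.x i)
    | Var.q => MvPolynomial.X Var.q
    | Var.t => MvPolynomial.X Var.t

theorem var_ne_zero {n : ℕ} (v : Var n) : var v ≠ 0 := by
  unfold var
  simp

theorem thetaPoly_injective {n : ℕ} (l : Fin n) :
    Function.Injective (thetaPoly l).toRingHom := by
  let back : MvPolynomial (Var n) ℝ →ₐ[ℝ] RatFn n :=
    MvPolynomial.aeval fun v => match v with
      | Var.x i => if i = l then (var Var.q)⁻¹ * var (Var.x i) else var (Var.x i)
      | Var.q => var Var.q
      | Var.t => var Var.t
  have h : back.comp (thetaPoly l) = Algebra.algHom ℝ (MvPolynomial (Var n) ℝ) (RatFn n) := by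
    refine MvPolynomial.algHom_ext fun v => ?_
    rcases v with i | _ | _
    · by_cases hi : i = l
      · simp [back, thetaPoly, hi, var, Algebra.algHom]
      · simp [back, thetaPoly, hi, var, Algebra.algHom]
    · simp [back, thetaPoly, var, Algebra.algHom]
    · simp [back, thetaPoly, var, Algebra.algHom]
  intro a b hab
  apply IsFractionRing.injective (MvPolynomial (Var n) ℝ) (RatFn n)
  have h1 := DFunLike.congr_fun h a
  have h2 := DFunLike.congr_fun h b
  have h3 : thetaPoly l a = thetaPoly l b := hab
  have h4 : back (thetaPoly l a) = back (thetaPoly l b) := by rw [h3]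
  exact h1.symm.trans (h4.trans h2)

/-- The operator `Θ_l : f[X] ↦ f[X + (q-1)x_l]`, that is, the substitution `x_l ↦ q x_l` in
rational functions. -/
noncomputable def theta {n : ℕ} (l : Fin n) : RatFn n →+* RatFn n :=
  IsFractionRing.map (A := MvPolynomial (Var n) ℝ) (B := MvPolynomial (Var n) ℝ)
    (thetaPoly_injective l)

/-- The composition `Θ_{i_k} ⋯ Θ_{i_1}` (with `Θ_{i_1}` applied first) for
`I = {i_1 < ⋯ < i_k}`. -/
noncomputable def thetaSet {n : ℕ} (I : Finset (Fin n)) (f : RatFn n) : RatFn n :=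
  (I.sort (· ≤ ·)).foldl (fun g i => theta i g) f

/-- The resultant `R(U, V) = ∏ (u - v)` of the alphabets `U = {u_i : i ∈ I}` and
`V = {v_j : j ∈ J}`. -/
noncomputable def resultant {n : ℕ} (u : Fin n → RatFn n) (I : Finset (Fin n))
    (v : Fin n → RatFn n) (J : Finset (Fin n)) : RatFn n :=
  ∏ i ∈ I, ∏ j ∈ J, (u i - v j)

/-- The Macdonald operator
`M_k = t^{k(k-1)/2} ∑_{|I| = k} R(t X_I, X_I^c) / R(X_I, X_I^c) Θ_{i_k} ⋯ Θ_{i_1}`. -/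
noncomputable def macdonald {n : ℕ} (k : ℕ) (f : RatFn n) : RatFn n :=
  t n ^ k.choose 2 *
    ∑ I ∈ Finset.powersetCard k (Finset.univ : Finset (Fin n)),
      resultant (fun i => t n * x i) I x Iᶜ / resultant x I x Iᶜ * thetaSet I f

/-! ### Formal operators on the columns of determinants of complete functions -/

/-- A formal `n × n` matrix of complete functions: the entry `(m, Y)` stands for `S_m[Y]`. -/
abbrev SymbolMatrix (n : ℕ) : Type := Matrix (Fin n) (Fin n) (ℤ × RatFn n)

/-- The formal operator with rows `a` and `b`: in every column `l`,
`S_m[Y]` is replaced by `S_{m + a_l}[Y + b_l]`. -/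
noncomputable def columnOp {n : ℕ} (a : Fin n → ℤ) (b : Fin n → RatFn n) (A : SymbolMatrix n) :
    SymbolMatrix n :=
  Matrix.of fun i j => ((A i j).1 + a j, (A i j).2 + b j)

/-- The determinant `|S_m[Y]|` denoted by a formal matrix. -/
noncomputable def symbolDet {n : ℕ} (A : SymbolMatrix n) : RatFn n :=
  (Matrix.of fun i j => pleth (complete (A i j).1) (A i j).2).det

/-- The formal Jacobi–Trudi matrix of `S_λ[Y]`, with entries `S_{λ_i - i + j}[Y]`. -/
noncomputable def jacobiTrudi {n : ℕ} (lam : Fin n → ℕ) (Y : RatFn n) : SymbolMatrix n :=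
  Matrix.of fun i j => ((lam i : ℤ) - (i.val : ℤ) + (j.val : ℤ), Y)

end MacdonaldSchur

/-! Write `A_I` for the Jacobi–Trudi matrix at the alphabet X^{tq} + X_I(t-1), to which the
operators `Θ` with indices in `I` send X^{tq}, and w_I for the variables with x_a replaced by t x_a
when a ∈ I. The generating function of the S_m at this alphabet is that at X^{tq} times ∏(1 - x_a
z)/∏(1 - (w_I)_a z). Multiplying `A_I` by the Lagrange matrix L(w_I) cancels all denominators but
one in each column, so column a depends on (w_I)_a alone. Hence A_I L(w_I) has the columns of A_univ
D L(x) in I and those of A_∅ L(x) elsewhere, where D = diag(t^{n-1-j})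
(`mixColumns_mul_lagrangeMatrix`).

The ratio det L(w_I)/det L(x) of Vandermonde products is exactly the coefficient of the Macdonald
operator (`det_lagrangeMatrix_scaled`). So M_k S_λ · det L(x) is the sum over |I| = k of these mixed
determinants, i.e. the z^k coefficient of det((A_∅ + z A_univ D) L(x)). The factor det L(x) splits
off and cancels (`sum_det_mixColumns_mul`), and the columns of D supply the powers of t.

The power of q comes from X^{tq} + X^t = q X^{tq} and the homogeneity of S_m. -/

namespace MacdonaldSchur

open Finset

/-! ### Determinants of matrices with mixed columns -/

section Mixed

variable {ι R : Type*} [Fintype ι] [DecidableEq ι] [CommRing R]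

/-- The matrix whose columns in `I` are those of `N` and whose other columns are those of `M`. -/
def mixColumns (I : Finset ι) (M N : Matrix ι ι R) : Matrix ι ι R :=
  Matrix.of fun i j => if j ∈ I then N i j else M i j

theorem det_add_eq_sum_mixColumns (M N : Matrix ι ι R) :
    (M + N).det = ∑ I : Finset ι, (mixColumns I M N).det := by
  rw [← Matrix.det_transpose, Matrix.transpose_add, add_comm]
  refine ((Matrix.detRowAlternating (n := ι) (R := R)).toMultilinearMap.map_add_univ
    N.transpose M.transpose).trans (sum_congr rfl fun I _ => ?_)
  rw [← Matrix.det_transpose]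
  change Matrix.det _ = Matrix.det _
  congr 1
  ext i j
  by_cases h : i ∈ I <;> simp [mixColumns, Finset.piecewise, h]

theorem det_add_X_smul (M N : Matrix ι ι R) :
    (M.map Polynomial.C + (Polynomial.X : Polynomial R) • N.map Polynomial.C).det =
      ∑ I : Finset ι, Polynomial.X ^ I.card * Polynomial.C (mixColumns I M N).det := by
  rw [det_add_eq_sum_mixColumns]
  refine sum_congr rfl fun I _ => ?_
  have h := Matrix.det_mul_row (fun j => if j ∈ I then (Polynomial.X : Polynomial R) else 1)
    ((mixColumns I M N).map Polynomial.C)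
  rw [prod_ite_mem, univ_inter, prod_const] at h
  have hdet : ((mixColumns I M N).map Polynomial.C).det =
      Polynomial.C (mixColumns I M N).det := (RingHom.map_det Polynomial.C _).symm
  rw [← hdet, ← h]
  congr 1
  ext1 i j
  by_cases hj : j ∈ I <;> simp [mixColumns, hj]

theorem coeff_det_add_X_smul (k : ℕ) (M N : Matrix ι ι R) :
    (M.map Polynomial.C + (Polynomial.X : Polynomial R) • N.map Polynomial.C).det.coeff k =
      ∑ I ∈ powersetCard k univ, (mixColumns I M N).det := by
  rw [det_add_X_smul, Polynomial.finsetSum_coeff, powersetCard_eq_filter, powerset_univ,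
    sum_filter]
  refine sum_congr rfl fun I _ => ?_
  rw [Polynomial.coeff_mul_C, Polynomial.coeff_X_pow]
  simp [eq_comm]

/-- Right multiplication by `C` combines columns, so this fails for a single `I`. The sum over all
`I` of size `k` is a coefficient of det(M + zN), which is multiplicative in `C`. -/
theorem sum_det_mixColumns_mul (k : ℕ) (M N C : Matrix ι ι R) :
    ∑ I ∈ powersetCard k univ, (mixColumns I (M * C) (N * C)).det =
      (∑ I ∈ powersetCard k univ, (mixColumns I M N).det) * C.det := by
  rw [← coeff_det_add_X_smul, ← coeff_det_add_X_smul, Matrix.map_mul, Matrix.map_mul,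
    ← Matrix.smul_mul, ← Matrix.add_mul, Matrix.det_mul]
  have hdet : (C.map Polynomial.C).det = Polynomial.C C.det := (RingHom.map_det Polynomial.C _).symm
  rw [hdet, Polynomial.coeff_mul_C]

end Mixed

/-! ### The inverse of the Vandermonde matrix -/

section Lagrange

variable {n : ℕ} {R : Type*} [CommRing R]

/-- The coefficient of `α ^ j * β ^ (n - 1 - j)` in `∏ b ≠ a, (α - w b * β)`, at the index
`(j, a)`. -/
def lagrangeMatrix (w : Fin n → R) : Matrix (Fin n) (Fin n) R :=
  Matrix.of fun j a => ∑ s ∈ powersetCard j.val (univ.erase a), ∏ b ∈ univ.erase a \ s, -w b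

/-- The homogeneous form serves two specialisations: β = 1 for the Vandermonde product, and α = 1, β
= cz over power series for the cancellation of denominators. -/
theorem sum_pow_mul_lagrangeMatrix {A : Type*} [CommRing A] (φ : R →+* A) (w : Fin n → R)
    (α β : A) (a : Fin n) :
    ∑ j : Fin n, α ^ j.val * β ^ (n - 1 - j.val) * φ (lagrangeMatrix w j a) =
      ∏ b ∈ univ.erase a, (α - φ (w b) * β) := by
  have hcard : (univ.erase a : Finset (Fin n)).card = n - 1 := by simp
  have hn : n - 1 + 1 = n := by have := a.isLt; omega
  simp_rw [sub_eq_add_neg]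
  rw [prod_add, sum_powerset, hcard, hn, sum_range]
  refine sum_congr rfl fun j _ => ?_
  rw [lagrangeMatrix, Matrix.of_apply, map_sum, mul_sum]
  refine sum_congr rfl fun s hs => ?_
  obtain ⟨hsub, hs⟩ := mem_powersetCard.1 hs
  rw [prod_const, hs, map_prod]
  simp_rw [← neg_mul]
  rw [prod_mul_distrib, prod_const, card_sdiff_of_subset hsub, hcard, hs]
  simp only [map_neg]
  ring

theorem prod_prod_eq_prod_lt {ι M : Type*} [Fintype ι] [LinearOrder ι] [CommMonoid M]
    (f : ι → ι → M) :
    ∏ a, ∏ b ∈ univ.erase a, f a b = ∏ a, ∏ b with a < b, (f a b * f b a) := by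
  have h1 : ∀ a, ∏ b ∈ univ.erase a, f a b =
      (∏ b, if a < b then f a b else 1) * ∏ b, if b < a then f a b else 1 := fun a => by
    rw [← prod_mul_distrib, ← filter_ne', prod_filter]
    refine prod_congr rfl fun b _ => ?_
    rcases lt_trichotomy a b with h | h | h
    · simp [h, h.ne', h.not_gt]
    · simp [h]
    · simp [h, h.ne, h.not_gt]
  simp_rw [h1, prod_filter]
  rw [prod_mul_distrib, prod_comm (f := fun a b => if b < a then f a b else 1), ← prod_mul_distrib]
  refine prod_congr rfl fun a _ => ?_
  rw [← prod_mul_distrib]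
  refine prod_congr rfl fun b _ => ?_
  split_ifs <;> simp

/-- With c = t this is where t^{k(k-1)/2} arises: one factor for each pair inside `I`. Mixed pairs
contribute `g` of (inside, outside) whatever their order. -/
theorem prod_lt_ite_mem {ι M : Type*} [Fintype ι] [LinearOrder ι] [CommMonoid M]
    (I : Finset ι) (c : M) (g : ι → ι → M) :
    (∏ a, ∏ b with a < b, if a ∈ I then if b ∈ I then c else g a b else
        if b ∈ I then g b a else 1) =
      c ^ I.card.choose 2 * ∏ a ∈ I, ∏ b ∈ Iᶜ, g a b := by
  have hc : (∏ a, ∏ b with a < b, if a ∈ I ∧ b ∈ I then c else 1) = c ^ I.card.choose 2 := by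
    rw [← card_product_filter_lt, ← prod_const, prod_sigma', prod_ite, prod_const_one, mul_one]
    refine prod_bij' (fun p _ => (p.1, p.2)) (fun p _ => ⟨p.1, p.2⟩) ?_ ?_ ?_ ?_ ?_ <;>
      simp +contextual
  have hg : ∏ a ∈ I, ∏ b ∈ Iᶜ, g a b =
      ∏ a, ∏ b ∈ univ.erase a, if a ∈ I ∧ b ∉ I then g a b else 1 := by
    rw [← prod_subset (subset_univ I)]
    · refine prod_congr rfl fun a ha => ?_
      have hsub : Iᶜ ⊆ univ.erase a := fun b hb =>
        mem_erase.2 ⟨fun h => mem_compl.1 hb (h ▸ ha), mem_univ b⟩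
      rw [← prod_subset hsub]
      · exact prod_congr rfl fun b hb => by simp [ha, mem_compl.1 hb]
      · intro b _ hb
        simp [notMem_compl.1 hb]
    · intro a _ ha
      simp [ha]
  rw [← hc, hg, prod_prod_eq_prod_lt, ← prod_mul_distrib]
  refine prod_congr rfl fun a _ => ?_
  rw [← prod_mul_distrib]
  refine prod_congr rfl fun b _ => ?_
  by_cases ha : a ∈ I <;> by_cases hb : b ∈ I <;> simp [ha, hb]

/-- Lagrange interpolation makes Vandermonde times this matrix diagonal; each pair a < b enters the
diagonal product with both signs, and the Vandermonde determinant removes one of the two factors. -/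
theorem det_lagrangeMatrix [IsDomain R] {w : Fin n → R} (hw : Function.Injective w) :
    (lagrangeMatrix w).det = ∏ a, ∏ b with a < b, (w a - w b) := by
  have h : Matrix.vandermonde w * lagrangeMatrix w =
      Matrix.diagonal fun a => ∏ b ∈ univ.erase a, (w a - w b) := by
    ext i a
    have h := sum_pow_mul_lagrangeMatrix (RingHom.id R) w (w i) 1 a
    simp only [one_pow, mul_one, RingHom.id_apply] at h
    rw [Matrix.mul_apply]
    simp only [Matrix.vandermonde_apply, h]
    by_cases hia : i = a
    · subst hia; simp
    · rw [Matrix.diagonal_apply_ne _ hia]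
      exact prod_eq_zero (mem_erase.2 ⟨hia, mem_univ i⟩) (sub_self _)
  have hdet := congrArg Matrix.det h
  rw [Matrix.det_mul, Matrix.det_diagonal, prod_prod_eq_prod_lt] at hdet
  have hV : (Matrix.vandermonde w).det ≠ 0 := Matrix.det_vandermonde_ne_zero_iff.2 hw
  apply mul_left_cancel₀ hV
  rw [hdet, Matrix.det_vandermonde, ← prod_mul_distrib]
  refine prod_congr rfl fun a _ => ?_
  rw [← filter_lt_eq_Ioi, ← prod_mul_distrib]
  exact prod_congr rfl fun b _ => mul_comm _ _

end Lagrange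

/-! ### Plethysm with the power sums and the operators `Θ_l` -/

theorem psi_algebraMap {n : ℕ} (i : ℕ+) (p : MvPolynomial (Var n) ℝ) :
    psi i (algebraMap _ (RatFn n) p) = algebraMap _ (RatFn n) (MvPolynomial.expand (i : ℕ) p) := by
  rw [psi, IsFractionRing.map, IsLocalization.map_eq]
  rfl

theorem theta_algebraMap {n : ℕ} (l : Fin n) (p : MvPolynomial (Var n) ℝ) :
    theta l (algebraMap _ (RatFn n) p) = algebraMap _ (RatFn n) (thetaPoly l p) := by
  rw [theta, IsFractionRing.map, IsLocalization.map_eq]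
  rfl

theorem psi_var {n : ℕ} (i : ℕ+) (v : Var n) : psi i (var v) = var v ^ (i : ℕ) := by
  rw [var, psi_algebraMap, MvPolynomial.expand_X, map_pow]

theorem theta_q {n : ℕ} (l : Fin n) : theta l (q n) = q n := by
  simp [q, var, theta_algebraMap, thetaPoly]

theorem theta_t {n : ℕ} (l : Fin n) : theta l (t n) = t n := by
  simp [t, var, theta_algebraMap, thetaPoly]

theorem theta_x {n : ℕ} (l i : Fin n) : theta l (x i) = if i = l then q n * x i else x i := by
  by_cases h : i = l <;> simp [x, q, var, theta_algebraMap, thetaPoly, h]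

theorem theta_real {n : ℕ} (l : Fin n) (r : ℝ) :
    theta l (algebraMap ℝ (RatFn n) r) = algebraMap ℝ (RatFn n) r := by
  rw [IsScalarTower.algebraMap_apply ℝ (MvPolynomial (Var n) ℝ) (RatFn n), theta_algebraMap,
    AlgHom.commutes]

/-- It suffices to compare on generators; at x_l the two sides agree because Ψ_i raises q to the
power i as well. -/
theorem theta_psi {n : ℕ} (l : Fin n) (i : ℕ+) (E : RatFn n) :
    theta l (psi i E) = psi i (theta l E) := by
  suffices h : (theta l).comp (psi i) = (psi i).comp (theta l) from RingHom.congr_fun h E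
  refine IsLocalization.ringHom_ext (nonZeroDivisors (MvPolynomial (Var n) ℝ)) ?_
  refine MvPolynomial.ringHom_ext (fun r => ?_) (fun v => ?_)
  · simp only [RingHom.comp_apply, psi_algebraMap, theta_algebraMap,
      ← MvPolynomial.algebraMap_eq, AlgHom.commutes]
  · change theta l (psi i (var v)) = psi i (theta l (var v))
    rw [psi_var, map_pow]
    rcases v with a | _ | _
    · change theta l (x a) ^ _ = psi i (theta l (x a))
      rw [theta_x]
      split_ifs
      · rw [map_mul, mul_pow, x, q, psi_var, psi_var]
      · rw [x, psi_var]
    · change theta l (q n) ^ _ = psi i (theta l (q n))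
      rw [theta_q, q, psi_var]
    · change theta l (t n) ^ _ = psi i (theta l (t n))
      rw [theta_t, t, psi_var]

theorem theta_pleth {n : ℕ} (l : Fin n) (f : Sym) (E : RatFn n) :
    theta l (pleth f E) = pleth f (theta l E) := by
  simp only [pleth]
  induction f using MvPolynomial.induction_on with
  | C r => rw [MvPolynomial.aeval_C, MvPolynomial.aeval_C, theta_real]
  | add f g hf hg => rw [map_add, map_add, map_add, hf, hg]
  | mul_X f i hf => rw [map_mul, map_mul, map_mul, hf, MvPolynomial.aeval_X, MvPolynomial.aeval_X,
      theta_psi]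

theorem var_sub_one_ne_zero {n : ℕ} (v : Var n) : var v - 1 ≠ 0 := by
  rw [sub_ne_zero, var, ← map_one (algebraMap (MvPolynomial (Var n) ℝ) (RatFn n)), Ne,
    (IsFractionRing.injective (MvPolynomial (Var n) ℝ) (RatFn n)).eq_iff]
  intro h
  have := congrArg (MvPolynomial.eval fun _ => (0 : ℝ)) h
  simp at this

/-- Θ_l adds (q-1)x_l to X, and the denominator q-1 of X^{tq} cancels this factor. Since l ∉ s, the
terms already added are fixed. -/
theorem theta_Xtq_add {n : ℕ} (l : Fin n) (s : Finset (Fin n)) (hl : l ∉ s) :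
    theta l (Xtq n + ∑ a ∈ s, x a * (t n - 1)) =
      Xtq n + ∑ a ∈ insert l s, x a * (t n - 1) := by
  have hq : q n - 1 ≠ 0 := var_sub_one_ne_zero _
  have hs : theta l (∑ a ∈ s, x a * (t n - 1)) = ∑ a ∈ s, x a * (t n - 1) := by
    rw [map_sum]
    refine sum_congr rfl fun a ha => ?_
    rw [map_mul, map_sub, theta_t, map_one, theta_x, if_neg (ne_of_mem_of_not_mem ha hl)]
  have hX : theta l (X n) = X n + (q n - 1) * x l := by
    simp only [X]
    rw [map_sum, ← sum_erase_add _ _ (mem_univ l), ← sum_erase_add _ _ (mem_univ l), theta_x,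
      if_pos rfl, sum_congr rfl fun a ha => by rw [theta_x, if_neg (ne_of_mem_erase ha)]]
    ring
  rw [map_add, hs, sum_insert hl, Xtq, map_div₀, map_mul, hX, map_sub, map_sub, theta_t, theta_q,
    map_one]
  field_simp
  ring

theorem foldl_theta_pleth {n : ℕ} (f : Sym) (L : List (Fin n)) (s : Finset (Fin n))
    (hL : L.Nodup) (hs : ∀ a ∈ L, a ∉ s) :
    L.foldl (fun g i => theta i g) (pleth f (Xtq n + ∑ a ∈ s, x a * (t n - 1))) =
      pleth f (Xtq n + ∑ a ∈ L.toFinset ∪ s, x a * (t n - 1)) := by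
  induction L generalizing s with
  | nil => simp
  | cons l L ih =>
    rw [List.nodup_cons] at hL
    rw [List.foldl_cons, theta_pleth, theta_Xtq_add l s (hs l (by simp)), ih _ hL.2]
    · rw [List.toFinset_cons, union_insert, insert_union]
    · intro a ha h
      rcases mem_insert.1 h with rfl | h
      · exact hL.1 ha
      · exact hs a (List.mem_cons_of_mem _ ha) h

theorem thetaSet_pleth {n : ℕ} (f : Sym) (I : Finset (Fin n)) :
    thetaSet I (pleth f (Xtq n)) = pleth f (Xtq n + ∑ a ∈ I, x a * (t n - 1)) := by
  have h := foldl_theta_pleth f (I.sort (· ≤ ·)) ∅ (sort_nodup _ _) (by simp)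
  rw [sum_empty, add_zero, union_empty, sort_toFinset] at h
  exact h

theorem thetaSet_pleth_schur {n : ℕ} (lam : Fin n → ℕ) (I : Finset (Fin n)) :
    thetaSet I (pleth (schur lam) (Xtq n)) =
      (Matrix.of fun i j : Fin n => pleth (complete ((lam i : ℤ) - (i.val : ℤ) + (j.val : ℤ)))
        (Xtq n + ∑ a ∈ I, x a * (t n - 1))).det := by
  rw [thetaSet_pleth, pleth, schur, AlgHom.map_det]
  rfl

/-! ### Complete symmetric functions of alphabets -/

theorem pleth_completeNat_succ {n : ℕ} (m : ℕ) (E : RatFn n) :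
    ((m : RatFn n) + 1) * pleth (completeNat (m + 1)) E =
      ∑ i ∈ range (m + 1), psi i.succPNat E * pleth (completeNat (m - i)) E := by
  have h : algebraMap ℝ (RatFn n) ((m : ℝ) + 1)⁻¹ = ((m : RatFn n) + 1)⁻¹ := by
    rw [map_inv₀]; simp
  have h0 : (m : RatFn n) + 1 ≠ 0 := by exact_mod_cast m.succ_ne_zero
  rw [completeNat, sum_range]
  simp only [pleth, map_mul, map_sum, powerSum, MvPolynomial.aeval_X, MvPolynomial.aeval_C, h]
  rw [mul_inv_cancel_left₀ h0]

theorem psi_q_mul {n : ℕ} (i : ℕ+) (E : RatFn n) :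
    psi i (q n * E) = q n ^ (i : ℕ) * psi i E := by
  rw [map_mul, q, psi_var]

theorem pleth_completeNat_q_mul {n : ℕ} (m : ℕ) (E : RatFn n) :
    pleth (completeNat m) (q n * E) = q n ^ m * pleth (completeNat m) E := by
  induction m using Nat.strong_induction_on with
  | _ m ih =>
    cases m with
    | zero => simp [completeNat, pleth]
    | succ m =>
      have h0 : (m : RatFn n) + 1 ≠ 0 := by exact_mod_cast m.succ_ne_zero
      apply mul_left_cancel₀ h0
      rw [pleth_completeNat_succ, mul_left_comm, pleth_completeNat_succ, mul_sum]
      refine sum_congr rfl fun i hi => ?_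
      have hi : i ≤ m := by simpa [Nat.lt_succ_iff] using hi
      rw [psi_q_mul, ih (m - i) (by omega), Nat.succPNat_coe,
        show m + 1 = i.succ + (m - i) by omega, pow_add]
      ring

theorem pleth_complete_Xtq_add_Xt {n : ℕ} (m : ℤ) :
    pleth (complete m) (Xtq n + Xt n) = q n ^ m * pleth (complete m) (Xtq n) := by
  have hq : q n - 1 ≠ 0 := var_sub_one_ne_zero _
  have h : Xtq n + Xt n = q n * Xtq n := by
    rw [Xtq, Xt]
    field_simp
    ring
  rw [h, complete]
  split_ifs with hm
  · simp [pleth]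
  · lift m to ℕ using not_lt.1 hm
    rw [Int.toNat_natCast, pleth_completeNat_q_mul, zpow_natCast]

/-- The generating function `∑ S_m[E] z ^ m`. -/
noncomputable def genFn {n : ℕ} (E : RatFn n) : PowerSeries (RatFn n) :=
  PowerSeries.mk fun m => pleth (completeNat m) E

/-- The generating function `∑ Ψ_{m + 1}[E] z ^ m`. -/
noncomputable def powerGenFn {n : ℕ} (E : RatFn n) : PowerSeries (RatFn n) :=
  PowerSeries.mk fun m => psi m.succPNat E

theorem constantCoeff_genFn {n : ℕ} (E : RatFn n) : PowerSeries.constantCoeff (genFn E) = 1 := by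
  rw [← PowerSeries.coeff_zero_eq_constantCoeff_apply, genFn, PowerSeries.coeff_mk, completeNat,
    pleth, map_one]

theorem derivative_genFn {n : ℕ} (E : RatFn n) :
    PowerSeries.derivative (RatFn n) (genFn E) = powerGenFn E * genFn E := by
  ext m
  rw [PowerSeries.coeff_derivative, PowerSeries.coeff_mul, genFn, PowerSeries.coeff_mk, mul_comm,
    pleth_completeNat_succ, Nat.sum_antidiagonal_eq_sum_range_succ_mk]
  simp [powerGenFn]

/-- In characteristic zero, f' = pf determines each coefficient from the earlier ones. -/
theorem eq_of_derivative_eq_mul {K : Type*} [Field K] [CharZero K] {p f g : PowerSeries K}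
    (hf : PowerSeries.derivative K f = p * f) (hg : PowerSeries.derivative K g = p * g)
    (h0 : PowerSeries.constantCoeff f = PowerSeries.constantCoeff g) : f = g := by
  ext m
  induction m using Nat.strong_induction_on with
  | _ m ih =>
    cases m with
    | zero => simpa using h0
    | succ m =>
      have h1 : (m : K) + 1 ≠ 0 := by exact_mod_cast m.succ_ne_zero
      apply mul_right_cancel₀ h1
      rw [← PowerSeries.coeff_derivative, ← PowerSeries.coeff_derivative, hf, hg,
        PowerSeries.coeff_mul, PowerSeries.coeff_mul]
      refine sum_congr rfl fun ij hij => ?_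
      have hij := mem_antidiagonal.1 hij
      rw [ih ij.2 (by omega)]

theorem derivative_one_sub_C_mul_X {K : Type*} [Field K] (a : K) :
    PowerSeries.derivative K (1 - PowerSeries.C a * PowerSeries.X) =
      -(PowerSeries.mk fun m => a ^ (m + 1)) * (1 - PowerSeries.C a * PowerSeries.X) := by
  have h : (PowerSeries.mk fun m => a ^ (m + 1)) * (1 - PowerSeries.C a * PowerSeries.X) =
      PowerSeries.C a := by
    ext m
    rw [mul_sub, mul_one, mul_left_comm, ← mul_assoc]
    cases m with
    | zero => simp
    | succ m =>
      rw [map_sub, PowerSeries.coeff_succ_mul_X, PowerSeries.coeff_C_mul, PowerSeries.coeff_mk,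
        PowerSeries.coeff_mk, PowerSeries.coeff_C, if_neg m.succ_ne_zero]
      ring
  rw [neg_mul, h, map_sub, Derivation.leibniz, PowerSeries.derivative_X, PowerSeries.derivative_C]
  simp

/-- Both sides have constant term 1 and the same logarithmic derivative, since Ψ_i[x_a(t-1)] = (t
x_a)^i - x_a^i. -/
theorem genFn_add_mul {n : ℕ} (E : RatFn n) (a : Fin n) :
    genFn (E + x a * (t n - 1)) * (1 - PowerSeries.C (t n * x a) * PowerSeries.X) =
      genFn E * (1 - PowerSeries.C (x a) * PowerSeries.X) := by
  have hp : powerGenFn (E + x a * (t n - 1)) - PowerSeries.mk (fun m => (t n * x a) ^ (m + 1)) =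
      powerGenFn E - PowerSeries.mk fun m => x a ^ (m + 1) := by
    ext m
    simp only [powerGenFn, map_sub, PowerSeries.coeff_mk, map_add, map_mul, map_one, x, t, psi_var,
      Nat.succPNat_coe, Nat.succ_eq_add_one]
    ring
  refine eq_of_derivative_eq_mul (p := powerGenFn E - PowerSeries.mk fun m => x a ^ (m + 1)) ?_ ?_
    ?_
  · rw [← hp, Derivation.leibniz, derivative_genFn, derivative_one_sub_C_mul_X, smul_eq_mul,
      smul_eq_mul]
    ring
  · rw [Derivation.leibniz, derivative_genFn, derivative_one_sub_C_mul_X, smul_eq_mul,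
      smul_eq_mul]
    ring
  · simp [constantCoeff_genFn]

theorem genFn_add_sum_mul {n : ℕ} (E : RatFn n) (I : Finset (Fin n)) :
    genFn (E + ∑ a ∈ I, x a * (t n - 1)) *
        ∏ a ∈ I, (1 - PowerSeries.C (t n * x a) * PowerSeries.X) =
      genFn E * ∏ a ∈ I, (1 - PowerSeries.C (x a) * PowerSeries.X) := by
  induction I using Finset.induction_on with
  | empty => simp
  | insert b I hb ih =>
    rw [prod_insert hb, prod_insert hb, sum_insert hb, add_comm (x b * _), ← add_assoc, ← mul_assoc,
      genFn_add_mul, mul_right_comm, ih]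
    ring

/-! ### The alphabets `t X_I + X_I^c` and partial fractions -/

/-- The alphabet obtained from `x` by multiplying the `x_a`, `a ∈ I`, by `t`. -/
noncomputable def scaled {n : ℕ} (I : Finset (Fin n)) (a : Fin n) : RatFn n :=
  if a ∈ I then t n * x a else x a

theorem scaled_injective {n : ℕ} (I : Finset (Fin n)) : Function.Injective (scaled I) := by
  let p : Fin n → MvPolynomial (Var n) ℝ := fun a =>
    if a ∈ I then MvPolynomial.X Var.t * MvPolynomial.X (Var.x a) else MvPolynomial.X (Var.x a)
  have hp : scaled I = fun a => algebraMap _ (RatFn n) (p a) := by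
    funext a
    by_cases h : a ∈ I <;> simp [scaled, p, h, t, x, var]
  intro a b hab
  rw [hp] at hab
  have h := IsFractionRing.injective (MvPolynomial (Var n) ℝ) (RatFn n) hab
  by_contra hne
  -- The point x_a = t = 1 with all other x_i = 0 gives the a-th entry the value 1 and the b-th the
  -- value 0.
  have h := congrArg (MvPolynomial.eval fun v => match v with
    | Var.x i => if i = a then (1 : ℝ) else 0
    | Var.q => 1
    | Var.t => 1) h
  have hne' : b ≠ a := fun h => hne h.symm
  by_cases ha : a ∈ I <;> by_cases hb : b ∈ I <;> simp [p, ha, hb, hne'] at h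

theorem scaled_empty {n : ℕ} : scaled (∅ : Finset (Fin n)) = x := by
  funext a; simp [scaled]

theorem x_injective {n : ℕ} : Function.Injective (x : Fin n → RatFn n) :=
  scaled_empty (n := n) ▸ scaled_injective ∅

theorem det_lagrangeMatrix_scaled {n : ℕ} (I : Finset (Fin n)) :
    (lagrangeMatrix (scaled I)).det =
      t n ^ I.card.choose 2 * (resultant (fun i => t n * x i) I x Iᶜ / resultant x I x Iᶜ) *
        (lagrangeMatrix (x (n := n))).det := by
  have hres : resultant (fun i => t n * x i) I x Iᶜ / resultant x I x Iᶜ =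
      ∏ a ∈ I, ∏ b ∈ Iᶜ, (t n * x a - x b) / (x a - x b) := by
    simp only [resultant, prod_div_distrib]
  rw [det_lagrangeMatrix (scaled_injective I), det_lagrangeMatrix x_injective, hres,
    ← prod_lt_ite_mem I (t n) fun a b => (t n * x a - x b) / (x a - x b), ← prod_mul_distrib]
  refine prod_congr rfl fun a _ => ?_
  rw [← prod_mul_distrib]
  refine prod_congr rfl fun b hb => ?_
  have hab : a < b := (mem_filter.1 hb).2
  have h1 : x a - x b ≠ 0 := sub_ne_zero.2 fun h => hab.ne (x_injective h)
  have h2 : x b - x a ≠ 0 := sub_ne_zero.2 fun h => hab.ne' (x_injective h)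
  by_cases ha : a ∈ I <;> by_cases hb : b ∈ I <;> simp only [scaled, ha, hb, if_true, if_false]
  · ring
  · rw [div_mul_cancel₀ _ h1]
  · field_simp
    ring
  · rw [one_mul]

/-- The power series `1 - c z`. -/
noncomputable def linearFactor {K : Type*} [Field K] (c : K) : PowerSeries K :=
  1 - PowerSeries.C c * PowerSeries.X

theorem constantCoeff_prod_linearFactor {ι K : Type*} [Field K] (s : Finset ι) (w : ι → K) :
    PowerSeries.constantCoeff (∏ a ∈ s, linearFactor (w a)) ≠ 0 := by
  simp [map_prod, linearFactor]

/-- The power series `∏ (1 - x_a z) / ∏ (1 - w_a z)`. -/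
noncomputable def factorRatio {n : ℕ} (w : Fin n → RatFn n) : PowerSeries (RatFn n) :=
  (∏ a, linearFactor (x a)) * (∏ a, linearFactor (w a))⁻¹

theorem genFn_Xtq_add {n : ℕ} (I : Finset (Fin n)) :
    genFn (Xtq n + ∑ a ∈ I, x a * (t n - 1)) = genFn (Xtq n) * factorRatio (scaled I) := by
  have h := congrArg (· * ∏ a ∈ Iᶜ, linearFactor (x a)) (genFn_add_sum_mul (Xtq n) I)
  have h1 : ∏ a, linearFactor (scaled I a) =
      (∏ a ∈ I, linearFactor (t n * x a)) * ∏ a ∈ Iᶜ, linearFactor (x a) := by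
    rw [← prod_mul_prod_compl I]
    congr 1
    · exact prod_congr rfl fun a ha => by rw [scaled, if_pos ha]
    · exact prod_congr rfl fun a ha => by rw [scaled, if_neg (mem_compl.1 ha)]
  have h2 : genFn (Xtq n + ∑ a ∈ I, x a * (t n - 1)) * ∏ a, linearFactor (scaled I a) =
      genFn (Xtq n) * ∏ a, linearFactor (x a) := by
    rw [h1, ← prod_mul_prod_compl I fun a => linearFactor (x a), ← mul_assoc, ← mul_assoc]
    exact h
  rw [factorRatio, ← mul_assoc, ← h2, mul_assoc,
    PowerSeries.mul_inv_cancel _ (constantCoeff_prod_linearFactor _ _), mul_one]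

/-- The column yields ∏_{b≠a}(1 - w_b z), which cancels all denominators but the a-th. The scalar c
allows w = t x to be treated with the Lagrange matrix of x itself. -/
theorem sum_lagrangeMatrix_mul_factorRatio {n : ℕ} (c : RatFn n) (v w : Fin n → RatFn n)
    (hw : ∀ a, w a = c * v a) (a : Fin n) :
    ∑ j : Fin n, (c ^ (n - 1 - j.val) * lagrangeMatrix v j a) •
        (PowerSeries.X ^ (n - 1 - j.val) * factorRatio w) =
      (∏ a, linearFactor (x a)) * (linearFactor (w a))⁻¹ := by
  have h := sum_pow_mul_lagrangeMatrix (PowerSeries.C (R := RatFn n)) v 1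
    (PowerSeries.C c * PowerSeries.X) a
  have h1 : ∏ b ∈ univ.erase a, (1 - PowerSeries.C (v b) * (PowerSeries.C c * PowerSeries.X)) =
      ∏ b ∈ univ.erase a, linearFactor (w b) := by
    refine prod_congr rfl fun b _ => ?_
    rw [linearFactor, hw, mul_comm c, map_mul, mul_assoc]
  have h2 : (∏ b ∈ univ.erase a, linearFactor (w b)) * (∏ b, linearFactor (w b))⁻¹ =
      (linearFactor (w a))⁻¹ := by
    rw [← prod_erase_mul univ _ (mem_univ a), PowerSeries.mul_inv_rev, mul_left_comm,
      PowerSeries.mul_inv_cancel _ (constantCoeff_prod_linearFactor _ _), mul_one]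
  rw [← h2, ← h1, ← h, sum_mul, mul_sum]
  refine sum_congr rfl fun j _ => ?_
  rw [PowerSeries.smul_eq_C_mul, factorRatio, one_pow, one_mul, mul_pow, map_mul, map_pow]
  ring

/-! ### Jacobi–Trudi matrices -/

/-- The coefficient extraction giving the `i`-th row of the Jacobi–Trudi matrices. -/
noncomputable def rowCoeff {n : ℕ} (lam : Fin n → ℕ) (i : Fin n) :
    PowerSeries (RatFn n) →ₗ[RatFn n] RatFn n :=
  (PowerSeries.coeff (lam i + (n - 1 - i.val))).comp
    (LinearMap.mulLeft (RatFn n) (genFn (Xtq n)))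

/-- The Jacobi–Trudi matrix of `S_λ` at the alphabet `X^{tq}` with `X_I (t - 1)` added. -/
noncomputable def shiftedJacobiTrudi {n : ℕ} (lam : Fin n → ℕ) (I : Finset (Fin n)) :
    Matrix (Fin n) (Fin n) (RatFn n) :=
  Matrix.of fun i j => pleth (complete ((lam i : ℤ) - (i.val : ℤ) + (j.val : ℤ)))
    (Xtq n + ∑ a ∈ I, x a * (t n - 1))

/-- The offset n-1 keeps the exponents natural: the net degree is λ_i - i + j, and when it is
negative both sides vanish. -/
theorem rowCoeff_X_pow_mul {n : ℕ} (lam : Fin n → ℕ) (I : Finset (Fin n)) (i j : Fin n) :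
    rowCoeff lam i (PowerSeries.X ^ (n - 1 - j.val) * factorRatio (scaled I)) =
      shiftedJacobiTrudi lam I i j := by
  have hi := i.isLt
  have hj := j.isLt
  rw [rowCoeff, LinearMap.comp_apply, LinearMap.mulLeft_apply, mul_left_comm, ← genFn_Xtq_add,
    PowerSeries.coeff_X_pow_mul', shiftedJacobiTrudi, Matrix.of_apply, complete]
  by_cases h : n - 1 - j.val ≤ lam i + (n - 1 - i.val)
  · rw [if_pos h, if_neg (by omega), genFn, PowerSeries.coeff_mk]
    congr 2
    omega
  · rw [if_neg h, if_pos (by omega), pleth, map_zero]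

theorem shiftedJacobiTrudi_mul_lagrangeMatrix {n : ℕ} (lam : Fin n → ℕ) (I : Finset (Fin n))
    (c : RatFn n) (v : Fin n → RatFn n) (hv : ∀ a, scaled I a = c * v a) (i a : Fin n) :
    ((Matrix.of fun i j => c ^ (n - 1 - j.val) * shiftedJacobiTrudi lam I i j) *
        lagrangeMatrix v) i a =
      rowCoeff lam i ((∏ a, linearFactor (x a)) * (linearFactor (scaled I a))⁻¹) := by
  rw [← sum_lagrangeMatrix_mul_factorRatio c v _ hv, map_sum, Matrix.mul_apply]
  refine sum_congr rfl fun j _ => ?_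
  rw [map_smul, rowCoeff_X_pow_mul, Matrix.of_apply, smul_eq_mul]
  ring

/-- Column a sees `I` only through `scaled I a`, which agrees with the value for `univ` (all t x_a)
when a ∈ I and for `∅` (all x_a) otherwise. -/
theorem mixColumns_mul_lagrangeMatrix {n : ℕ} (lam : Fin n → ℕ) (I : Finset (Fin n)) :
    mixColumns I (shiftedJacobiTrudi lam ∅ * lagrangeMatrix x)
        ((Matrix.of fun i j => t n ^ (n - 1 - j.val) * shiftedJacobiTrudi lam univ i j) *
          lagrangeMatrix x) =
      shiftedJacobiTrudi lam I * lagrangeMatrix (scaled I) := by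
  ext i a
  have hone : ∀ J : Finset (Fin n), (shiftedJacobiTrudi lam J * lagrangeMatrix (scaled J)) i a =
      rowCoeff lam i ((∏ a, linearFactor (x a)) * (linearFactor (scaled J a))⁻¹) := fun J => by
    rw [← shiftedJacobiTrudi_mul_lagrangeMatrix lam J 1 (scaled J) (by simp)]
    simp only [one_pow, one_mul]
    rfl
  rw [hone, mixColumns, Matrix.of_apply]
  by_cases h : a ∈ I
  · rw [if_pos h, shiftedJacobiTrudi_mul_lagrangeMatrix lam univ (t n) x (by simp [scaled])]
    simp [scaled, h]
  · have h0 := hone ∅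
    rw [scaled_empty] at h0
    rw [if_neg h, h0, scaled, if_neg h]

/-! ### Assembly of the two determinant formulas. -/

theorem sum_x_mul {n : ℕ} : ∑ a, x a * (t n - 1) = Xt n := by
  rw [Xt, X, sum_mul]

theorem det_mixColumns_shiftedJacobiTrudi {n : ℕ} (lam : Fin n → ℕ) (I : Finset (Fin n)) :
    (mixColumns I (shiftedJacobiTrudi lam ∅)
        (Matrix.of fun i j => t n ^ (n - 1 - j.val) * shiftedJacobiTrudi lam univ i j)).det =
      t n ^ (∑ i ∈ I, (n - (i.val + 1))) *
        symbolDet (columnOp (fun _ => 0) (fun j => if j ∈ I then Xt n else 0)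
          (jacobiTrudi lam (Xtq n))) := by
  have hpow : t n ^ (∑ i ∈ I, (n - (i.val + 1))) =
      ∏ j, if j ∈ I then t n ^ (n - (j.val + 1)) else 1 := by
    rw [prod_ite_mem, univ_inter, prod_pow_eq_pow_sum]
  rw [hpow, symbolDet, ← Matrix.det_mul_row]
  congr 1
  ext1 i j
  by_cases hj : j ∈ I
  · simp [mixColumns, shiftedJacobiTrudi, columnOp, jacobiTrudi, hj, sum_x_mul, Nat.sub_sub,
      add_comm 1]
  · simp [mixColumns, shiftedJacobiTrudi, columnOp, jacobiTrudi, hj]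

theorem macdonald_pleth_schur {n : ℕ} (k : ℕ) (lam : Fin n → ℕ) :
    macdonald k (pleth (schur lam) (Xtq n)) =
      ∑ I ∈ powersetCard k (univ : Finset (Fin n)),
        t n ^ (∑ i ∈ I, (n - (i.val + 1))) *
          symbolDet (columnOp (fun _ => 0) (fun j => if j ∈ I then Xt n else 0)
            (jacobiTrudi lam (Xtq n))) := by
  have hdet : (lagrangeMatrix (x (n := n))).det ≠ 0 := by
    rw [det_lagrangeMatrix x_injective]
    exact prod_ne_zero_iff.2 fun a _ => prod_ne_zero_iff.2 fun b hb =>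
      sub_ne_zero.2 fun h => (mem_filter.1 hb).2.ne (x_injective h)
  -- After multiplication by det L(x), the left side matches the mixed determinants term by term;
  -- the right side is brought to that form only as a whole sum.
  apply mul_right_cancel₀ hdet
  simp_rw [← det_mixColumns_shiftedJacobiTrudi]
  rw [← sum_det_mixColumns_mul, macdonald, mul_sum, sum_mul]
  refine sum_congr rfl fun I hI => ?_
  rw [mixColumns_mul_lagrangeMatrix, Matrix.det_mul, det_lagrangeMatrix_scaled,
    (mem_powersetCard.1 hI).2, thetaSet_pleth_schur]
  change _ * (_ * (shiftedJacobiTrudi lam I).det) * _ = _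
  ring

theorem symbolDet_columnOp_jacobiTrudi {n : ℕ} (lam : Fin n → ℕ) (I : Finset (Fin n)) :
    symbolDet (columnOp (fun _ => 0) (fun j => if j ∈ I then Xt n else 0)
        (jacobiTrudi lam (Xtq n))) =
      (Matrix.of fun i j : Fin n =>
        (if j ∈ I then q n ^ ((lam i : ℤ) - (i.val : ℤ) + (j.val : ℤ)) else 1) *
          pleth (complete ((lam i : ℤ) - (i.val : ℤ) + (j.val : ℤ))) (Xtq n)).det := by
  rw [symbolDet]
  congr 1
  ext1 i j
  by_cases hj : j ∈ I
  · simp [columnOp, jacobiTrudi, hj, pleth_complete_Xtq_add_Xt]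
  · simp [columnOp, jacobiTrudi, hj]

end MacdonaldSchur

theorem theorem2p1 (n k : ℕ) (lam : Fin n → ℕ) (hlam : Antitone lam) :
    (MacdonaldSchur.macdonald k
        (MacdonaldSchur.pleth (MacdonaldSchur.schur lam) (MacdonaldSchur.Xtq n)) =
      ∑ I ∈ Finset.powersetCard k (Finset.univ : Finset (Fin n)),
        MacdonaldSchur.t n ^ (∑ i ∈ I, (n - (i.val + 1))) *
          MacdonaldSchur.symbolDet
            (MacdonaldSchur.columnOp (fun _ => 0)
              (fun j => if j ∈ I then MacdonaldSchur.Xt n else 0)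
              (MacdonaldSchur.jacobiTrudi lam (MacdonaldSchur.Xtq n)))) ∧
    (∀ m : ℤ,
      MacdonaldSchur.pleth (MacdonaldSchur.complete m)
          (MacdonaldSchur.Xtq n + MacdonaldSchur.Xt n) =
        MacdonaldSchur.q n ^ m *
          MacdonaldSchur.pleth (MacdonaldSchur.complete m) (MacdonaldSchur.Xtq n)) ∧
    (MacdonaldSchur.macdonald k
        (MacdonaldSchur.pleth (MacdonaldSchur.schur lam) (MacdonaldSchur.Xtq n)) =
      ∑ I ∈ Finset.powersetCard k (Finset.univ : Finset (Fin n)),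
        MacdonaldSchur.t n ^ (∑ i ∈ I, (n - (i.val + 1))) *
          (Matrix.of fun i j : Fin n =>
            (if j ∈ I then
                MacdonaldSchur.q n ^ ((lam i : ℤ) - (i.val : ℤ) + (j.val : ℤ)) else 1) *
              MacdonaldSchur.pleth
                (MacdonaldSchur.complete ((lam i : ℤ) - (i.val : ℤ) + (j.val : ℤ)))
                (MacdonaldSchur.Xtq n)).det) := by
  refine ⟨MacdonaldSchur.macdonald_pleth_schur k lam, MacdonaldSchur.pleth_complete_Xtq_add_Xt, ?_⟩
  rw [MacdonaldSchur.macdonald_pleth_schur]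
  exact Finset.sum_congr rfl fun I _ => by rw [MacdonaldSchur.symbolDet_columnOp_jacobiTrudi]
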